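/- For a positive integer $n$ and a set $A$ of integers, let $\mathrm{Cay}(\mathbb{Z}_n;A)$ be the digraph with vertex set $\mathbb{Z}_n=\mathbb{Z}/n\mathbb{Z}$ in which there is an arc from $u$ to $u+a$ for every $u\in\mathbb{Z}_n$ and every $a\in A$. A hamiltonian circuit is a directed circuit that visits every vertex exactly once. **Theorem 4.6.** Let $k\ge 1$ be an integer and let $a,b$ be integers. The circulant digraph $\mathrm{Cay}(\mathbb{Z}_{2k};a,b,b+k)$ has a hamiltonian circuit if and only if $\gcd(a,b,k)=1$ and at least one of the following holds: - $\gcd(a-b,k)\neq 1$; - $\gcd(a,2k)=1$; - $\gcd(b,k)=1$; - both $a$ and $k$ are even; - $a$ is odd, and at least one of $b$ and $k$ is odd. Moreover, for infinitely many $k$ there are integers $a,b$ such that $\mathrm{Cay}(\mathbb{Z}_{2k};a,b,b+k)$ is (strongly) connected, has no loops, has outdegree $3$ at every vertex, and has no hamiltonian circuit. -/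

import Mathlib

/-- The circulant digraph `Cay(ℤ_n; A)`: there is an arc from `u` to `u + a` for every
`u ∈ ℤ_n` and every `a ∈ A`, where `A` is a set of integers. -/
def cayZMod (n : ℕ) (A : Set ℤ) : Digraph (ZMod n) where
  Adj u v := ∃ a ∈ A, v = u + (a : ZMod n)

namespace Digraph

/-- A hamiltonian circuit of a finite digraph: a cyclic sequence `c 0, c 1, …, c (m - 1)`
(indexed by `ZMod m`, `m > 0`, so that `c (m - 1)` is followed by `c 0`), visiting every vertex
exactly once, with an arc from each term to the next. -/
def HasHamiltonianCircuit {V : Type*} [Finite V] (G : Digraph V) : Prop :=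
  ∃ m : ℕ, 0 < m ∧ ∃ c : ZMod m → V,
    Function.Bijective c ∧ ∀ i : ZMod m, G.Adj (c i) (c (i + 1))

/-- Every vertex can be reached from every vertex by a directed path. -/
def IsStronglyConnected {V : Type*} (G : Digraph V) : Prop :=
  ∀ u v : V, Relation.ReflTransGen G.Adj u v

/-- Every vertex has exactly `d` out-neighbours. -/
def HasOutdegree {V : Type*} (G : Digraph V) (d : ℕ) : Prop :=
  ∀ u : V, {v : V | G.Adj u v}.ncard = d

/-- No vertex has an arc to itself. -/
def IsLoopless {V : Type*} (G : Digraph V) : Prop :=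
  ∀ u : V, ¬ G.Adj u u

end Digraph

/-!
A hamiltonian circuit is a permutation `s` of `ZMod (2 * k)` with a single cycle such that each `s v`
is one of `v + a`, `v + b`, `v + b + k` (`hasHamiltonianCircuit_iff`). Let `π` be the reduction
modulo `k`; its fibres are the pairs `{v, v + k}`.

*Necessity.* A common divisor of `a`, `b`, `k` would give a residue that is constant along the
circuit. Suppose that `b - a` generates `ZMod k`. Counting the preimages of a pair shows that the
number of vertices that move by `a` is the same in all pairs (`IsPairing.trichotomy`). If it is `2`,
then `s` is the translation by `a`, so `a` generates `ZMod (2 * k)`; if it is `0`, then `b` generates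
`ZMod k`. If it is `1` (`IsMixed`), then `s` composed with the translation by `-a` is a cycle of
length `k`, so that `s` has sign `(-1) ^ (a + k - 1)` (`IsMixed.sign_eq`). A cycle of length `2 * k`
is odd, which forces `a` and `k` to have the same parity.

*Sufficiency.* If `a` generates `ZMod (2 * k)` or `b` generates `ZMod k`, there is a translation that
works. Otherwise a permutation is chosen whose partition into cycles is maximal, using that
`p * swap u v` merges the cycles of `u` and `v` when these are distinct.

If `g = gcd (a - b) k` is not `1`, every move changes the residue modulo `g` by that of `a`, and moves
can be chosen level by level: by `b` or `b + k` on one level, mixed on the next one, by `a` elsewhere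
(`IsLayered`). The pairs of the first level may be transposed freely, so for a maximal permutation
each of them lies on one cycle. The mixed level then joins `y` to `y + (b - a)` for all `y` of the
first level, which leaves a single cycle (`exists_isLayered_isTransitive`).

If `g = 1` and `a`, `k` have the same parity, consider mixed permutations. Exchanging the roles of
`x` and `x + k` amounts, up to conjugation, to transposing the pairs of `x` and `x + a`
(`IsMixed.swap_mul_mul_swap`); hence any two pairs in one coset of the subgroup generated by `a` and
`k` may be transposed together. If a maximal permutation has a pair `{x, x + k}` that meets two
cycles, then by parity there is a third cycle (`exists_third_cycle`). It meets the coset of `x`,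
because only permutations whose cycles all contain a move by `b` are admitted (`IsMergeable`), and
each pair that it meets there lies on it entirely, since otherwise transposing this pair and that of
`x` would merge cycles. So with a pair of `z` it also contains that of `z + a`, and finally that of
`x`, a contradiction (`exists_isMixed_isTransitive`).
-/

/-! ### Merging the cycles of a permutation -/

namespace Equiv.Perm

variable {α : Type*}

/-- All points lie on one cycle of `p`. -/
def IsTransitive (p : Perm α) : Prop := ∀ x y, p.SameCycle x y

/-- The partition into cycles is the finest one that is preserved by each step of `q`. -/
theorem SameCycle.of_forall_apply {q : Perm α} (r : Setoid α) (h : ∀ x, r x (q x)) {x y : α}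
    (hxy : q.SameCycle x y) : r x y := by
  obtain ⟨i, rfl⟩ := hxy
  induction i with
  | zero => exact r.refl _
  | succ n ih => rw [add_comm, zpow_add, zpow_one]; exact r.trans ih (h _)
  | pred n ih =>
    refine r.trans ih (r.symm ?_)
    have := h ((q ^ (-(n : ℤ) - 1)) x)
    rwa [← mul_apply, ← zpow_one_add, add_sub_cancel] at this

/-- A function that is constant along the steps of `q` is constant on its cycles. -/
theorem SameCycle.apply_eq_of_forall {β : Type*} {q : Perm α} (f : α → β)
    (h : ∀ x, f (q x) = f x) {x y : α} (hxy : q.SameCycle x y) : f x = f y :=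
  SameCycle.of_forall_apply (Setoid.ker f) (fun x => (h x).symm) hxy

theorem sameCycle_apply_self (p : Perm α) (x : α) : p.SameCycle x (p x) := ⟨1, by simp⟩

section Merge

variable [DecidableEq α] {p : Perm α} {u v : α}

/-- The cycle of `p` through `v` becomes a path that starts at the new image of `u`. -/
theorem sameCycle_mul_swap_pow (h : ¬ p.SameCycle u v) (i : ℕ) :
    (p * swap u v).SameCycle u ((p ^ i) (p v)) := by
  induction i with
  | zero => exact ⟨1, by simp⟩
  | succ n ih =>
    rw [pow_succ', mul_apply]
    set w := (p ^ n) (p v) with hw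
    have hvw : p.SameCycle v w := ⟨n + 1, by rw [zpow_add_one, zpow_natCast, mul_apply]⟩
    rcases eq_or_ne w v with h1 | h1
    · rw [h1]; exact ⟨1, by simp⟩
    · have h2 : w ≠ u := fun h2 => h (h2 ▸ hvw.symm)
      refine ih.trans ⟨1, ?_⟩
      simp [swap_apply_of_ne_of_ne h2 h1]

/-- Composing with a transposition of two points on different cycles joins these cycles. -/
theorem sameCycle_mul_swap_self [Finite α] (h : ¬ p.SameCycle u v) : (p * swap u v).SameCycle u v := by
  have hv : p.SameCycle (p v) v := ⟨-1, by simp⟩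
  obtain ⟨i, hi⟩ := hv.exists_nat_pow_eq
  have := sameCycle_mul_swap_pow h i
  rwa [hi] at this

theorem SameCycle.mul_swap [Finite α] (h : ¬ p.SameCycle u v) {x y : α} (hxy : p.SameCycle x y) :
    (p * swap u v).SameCycle x y := by
  refine SameCycle.of_forall_apply (SameCycle.setoid (p * swap u v)) (fun x => ?_) hxy
  change (p * swap u v).SameCycle x (p x)
  have huv := sameCycle_mul_swap_self h
  rcases eq_or_ne x u with rfl | h1
  · exact huv.trans ⟨1, by simp⟩
  rcases eq_or_ne x v with rfl | h2
  · exact huv.symm.trans ⟨1, by simp⟩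
  exact ⟨1, by simp [swap_apply_of_ne_of_ne h1 h2]⟩

/-- Composing with the transposition of `u` and `v` joins no cycles besides those of `u` and `v`. -/
theorem SameCycle.of_mul_swap {x y : α} (hxy : (p * swap u v).SameCycle x y) :
    p.SameCycle x y ∨ ((p.SameCycle u x ∨ p.SameCycle v x) ∧
      (p.SameCycle u y ∨ p.SameCycle v y)) := by
  let r : Setoid α :=
    { r := fun x y => p.SameCycle x y ∨ ((p.SameCycle u x ∨ p.SameCycle v x) ∧
        (p.SameCycle u y ∨ p.SameCycle v y))
      iseqv :=
        { refl := fun x => Or.inl (SameCycle.refl _ _)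
          symm := by
            rintro x y (h | h)
            · exact Or.inl h.symm
            · exact Or.inr h.symm
          trans := by
            rintro x y z (h | ⟨h, h'⟩) (g | ⟨g, g'⟩)
            · exact Or.inl (h.trans g)
            · exact Or.inr ⟨g.imp (·.trans h.symm) (·.trans h.symm), g'⟩
            · exact Or.inr ⟨h, h'.imp (·.trans g) (·.trans g)⟩
            · exact Or.inr ⟨h, g'⟩ } }
  refine SameCycle.of_forall_apply r (fun x => ?_) hxy
  rcases eq_or_ne x u with rfl | h1
  · exact Or.inr ⟨Or.inl (SameCycle.refl _ _), Or.inr ⟨1, by simp⟩⟩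
  rcases eq_or_ne x v with rfl | h2
  · exact Or.inr ⟨Or.inr (SameCycle.refl _ _), Or.inl ⟨1, by simp⟩⟩
  exact Or.inl ⟨1, by simp [swap_apply_of_ne_of_ne h1 h2]⟩

end Merge

theorem IsTransitive.isCycleOn {p : Perm α} (h : p.IsTransitive) : p.IsCycleOn _root_.Set.univ :=
  ⟨p.bijective.bijOn_univ, fun x _ y _ => h x y⟩

/-- A single cycle of even length is an odd permutation. -/
theorem IsTransitive.sign_eq [Fintype α] [DecidableEq α] {p : Perm α} (h : p.IsTransitive)
    (hα : Even (Fintype.card α)) (hn : Nontrivial α) : sign p = -1 := by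
  have hc : p.IsCycle := isCycle_iff_exists_isCycleOn.2
    ⟨_root_.Set.univ, Set.nontrivial_univ, h.isCycleOn, fun _ _ => Set.mem_univ _⟩
  have hs : p.support = Finset.univ := by
    ext x
    simpa using h.isCycleOn.apply_ne Set.nontrivial_univ (Set.mem_univ x)
  rw [hc.sign, hs, Finset.card_univ, hα.neg_one_pow]

/-- A permutation of an even number of points that has exactly two cycles is even. Equivalently,
an odd permutation that is not a single cycle has a point outside any two given cycles. -/
theorem exists_third_cycle [Fintype α] [DecidableEq α] {p : Perm α}
    (hα : Even (Fintype.card α)) (hp : sign p = -1) {u v : α} (huv : ¬ p.SameCycle u v) :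
    ∃ w, ¬ p.SameCycle w u ∧ ¬ p.SameCycle w v := by
  by_contra! hw
  have hne : u ≠ v := fun h => huv (h ▸ SameCycle.refl _ _)
  have ht : (p * swap u v).IsTransitive := by
    have key : ∀ w, (p * swap u v).SameCycle w u := fun w => by
      by_cases h : p.SameCycle w u
      · exact h.mul_swap huv
      · exact ((hw w h).mul_swap huv).trans (sameCycle_mul_swap_self huv).symm
    exact fun x y => (key x).trans (key y).symm
  have := ht.sign_eq hα ⟨u, v, hne⟩
  rw [sign_mul, sign_swap hne, hp] at this
  simp at this

/-- A nonempty family of permutations of a finite set has a member whose partition into cycles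
is not a proper refinement of that of another member. -/
theorem exists_maximal_sameCycle [Finite α] {F : Set (Perm α)} (hF : F.Nonempty) :
    ∃ p ∈ F, ∀ q ∈ F, (∀ x y, p.SameCycle x y → q.SameCycle x y) →
      ∀ x y, q.SameCycle x y → p.SameCycle x y := by
  obtain ⟨p, hp, hmax⟩ := (Set.toFinite F).exists_maximalFor
    (fun p : Perm α => (SameCycle.setoid p)) F hF
  exact ⟨p, hp, fun q hq hpq x y hxy => hmax hq (fun {x y} h => hpq x y h) hxy⟩

end Equiv.Perm

/-! ### Mixed permutations: merging cycles two pairs at a time -/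

/-- `π : G → H` is a homomorphism whose kernel `{0, κ}` has order two. The fibres of
`π` are the pairs `{v, v + κ}`. -/
structure IsPairing {G H : Type*} [AddCommGroup G] [AddCommGroup H] (π : G →+ H) (κ : G) :
    Prop where
  eq_iff : ∀ u v, π u = π v ↔ u = v ∨ u = v + κ
  ne_zero : κ ≠ 0

section Mixed

open Equiv Equiv.Perm

variable {G H : Type*} [AddCommGroup G] [AddCommGroup H] {π : G →+ H} {κ a b : G}

namespace IsPairing

theorem map_eq_zero (h : IsPairing π κ) : π κ = 0 := by
  rw [← map_zero π, h.eq_iff]; simp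

theorem add_self (h : IsPairing π κ) : κ + κ = 0 := by
  have := (h.eq_iff 0 κ).1 (by rw [h.map_eq_zero, map_zero])
  exact (this.resolve_left h.ne_zero.symm).symm

theorem add_add (h : IsPairing π κ) (v : G) : v + κ + κ = v := by
  rw [add_assoc, h.add_self, add_zero]

theorem map_add_eq (h : IsPairing π κ) (v : G) : π (v + κ) = π v := by
  rw [map_add, h.map_eq_zero, add_zero]

theorem add_ne (h : IsPairing π κ) (v : G) : v + κ ≠ v := by simpa using h.ne_zero

theorem eq_add_of_ne (h : IsPairing π κ) {u v : G} (huv : π u = π v) (hne : u ≠ v) : u = v + κ :=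
  ((h.eq_iff u v).1 huv).resolve_left hne

variable [DecidableEq G]

theorem swap_add (h : IsPairing π κ) (v : G) : swap (v + κ) (v + κ + κ) = swap v (v + κ) := by
  rw [h.add_add, swap_comm]

theorem swap_congr (h : IsPairing π κ) {u v : G} (huv : π u = π v) :
    swap u (u + κ) = swap v (v + κ) := by
  rcases (h.eq_iff u v).1 huv with rfl | rfl
  · rfl
  · exact h.swap_add v

theorem map_swap (h : IsPairing π κ) (v w : G) : π (swap v (v + κ) w) = π w := by
  rw [swap_apply_def]
  split_ifs with h1 h2
  · rw [h1, h.map_add_eq]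
  · rw [h2, h.map_add_eq]
  · rfl

/-- The transposition of a pair commutes with every permutation that maps each pair to itself. -/
theorem commute_swap (h : IsPairing π κ) {W : Perm G} (hW : ∀ v, π (W v) = π v) (v : G) :
    Commute W (swap v (v + κ)) := by
  have h1 : W (v + κ) = W v + κ := by
    refine h.eq_add_of_ne ?_ fun hn => h.add_ne v (W.injective hn)
    rw [hW, hW, h.map_add_eq]
  have h2 := swap_apply_apply W v (v + κ)
  rw [h1, h.swap_congr (hW v)] at h2
  exact (mul_inv_eq_iff_eq_mul.1 h2.symm)

end IsPairing

/-- In each pair `{v, v + κ}`, one vertex is moved by `a`, and the other one by `b` or `b + κ`. -/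
def IsMixed (π : G →+ H) (κ a b : G) (s : G → G) : Prop :=
  ∀ v, (s v = v + a ∧ π (s (v + κ)) = π v + π b) ∨
    (s (v + κ) = v + κ + a ∧ π (s v) = π v + π b)

/-- The analogue of `IsMixed` for the images under `π`: in each pair, one vertex is moved by `a`
or `a + κ`, and the other one by `b` or `b + κ`. -/
def IsMixedMod (π : G →+ H) (κ a b : G) (s : G → G) : Prop :=
  ∀ v, (π (s v) = π v + π a ∧ π (s (v + κ)) = π v + π b) ∨
    (π (s (v + κ)) = π v + π a ∧ π (s v) = π v + π b)

/-- Conjugate to a mixed permutation by a permutation that maps each pair to itself. -/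
def IsConjMixed (π : G →+ H) (κ a b : G) (p : Perm G) : Prop :=
  ∃ W s : Perm G, (∀ v, π (W v) = π v) ∧ IsMixed π κ a b s ∧ p = W * s * W⁻¹

theorem IsMixed.isMixedMod (h : IsPairing π κ) {s : G → G} (hs : IsMixed π κ a b s) :
    IsMixedMod π κ a b s := fun v => by
  rcases hs v with ⟨h1, h2⟩ | ⟨h1, h2⟩
  · exact Or.inl ⟨by rw [h1, map_add], h2⟩
  · exact Or.inr ⟨by rw [h1, map_add, h.map_add_eq], h2⟩

theorem IsConjMixed.isMixedMod (h : IsPairing π κ) {p : Perm G} (hp : IsConjMixed π κ a b p) :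
    IsMixedMod π κ a b p := by
  obtain ⟨W, s, hW, hs, rfl⟩ := hp
  intro v
  have hW' : ∀ v, π (W⁻¹ v) = π v := fun v => by rw [← hW (W⁻¹ v)]; simp
  have h1 : W⁻¹ (v + κ) = W⁻¹ v + κ := by
    refine h.eq_add_of_ne ?_ fun hn => h.add_ne v (W⁻¹.injective hn)
    rw [hW', hW', h.map_add_eq]
  have := hs.isMixedMod h (W⁻¹ v)
  simpa only [mul_apply, hW, hW', h1] using this

section Decidable

variable [DecidableEq G]

/-- Exchanging the roles of `x` and `x + κ` in a mixed permutation: the vertex of the pair that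
used to be moved by `a` is now moved by `b` or `b + κ`, and conversely. -/
theorem IsMixed.swap_mul_mul_swap (h : IsPairing π κ)
    {s : Perm G} (hs : IsMixed π κ a b s) (x : G) :
    IsMixed π κ a b (swap (x + a) (x + a + κ) * s * swap x (x + κ)) := by
  intro v
  simp only [mul_apply, h.map_swap]
  by_cases hv : π v = π x
  · have h1 : swap x (x + κ) v = v + κ ∧ swap x (x + κ) (v + κ) = v := by
      rcases (h.eq_iff v x).1 hv with rfl | rfl
      · simp
      · simp [h.add_add]
    have h2 : swap (x + a) (x + a + κ) = swap (v + a) (v + a + κ) :=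
      h.swap_congr (by simp [hv])
    rw [h1.1, h1.2]
    rcases hs v with ⟨h3, h4⟩ | ⟨h3, h4⟩
    · refine Or.inr ⟨?_, h4⟩
      rw [h3, h2, swap_apply_left, add_right_comm]
    · refine Or.inl ⟨?_, h4⟩
      rw [h3, h2, add_right_comm, swap_apply_right]
  · have h1 : ∀ u, π u = π v → swap x (x + κ) u = u := fun u hu => by
      apply swap_apply_of_ne_of_ne <;> rintro rfl
      · exact hv hu.symm
      · exact hv (by rw [← hu, h.map_add_eq])
    have h2 : ∀ u, π u = π v → swap (x + a) (x + a + κ) (u + a) = u + a := fun u hu => by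
      apply swap_apply_of_ne_of_ne <;> intro hn <;> apply hv
      · rw [← hu, add_right_cancel hn]
      · rw [add_right_comm] at hn
        rw [← hu, add_right_cancel hn, h.map_add_eq]
    rw [h1 v rfl, h1 (v + κ) (h.map_add_eq v)]
    rcases hs v with ⟨h3, h4⟩ | ⟨h3, h4⟩
    · exact Or.inl ⟨by rw [h3, h2 v rfl], h4⟩
    · exact Or.inr ⟨by rw [h3, h2 _ (h.map_add_eq v)], h4⟩

theorem IsConjMixed.mul_swap_mul_swap_add (h : IsPairing π κ)
    {p : Perm G} (hp : IsConjMixed π κ a b p) (x : G) :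
    IsConjMixed π κ a b (p * swap x (x + κ) * swap (x + a) (x + a + κ)) := by
  obtain ⟨W, s, hW, hs, rfl⟩ := hp
  refine ⟨W * swap (x + a) (x + a + κ),
    swap (x + a) (x + a + κ) * s * swap x (x + κ), fun v => ?_,
    hs.swap_mul_mul_swap h x, ?_⟩
  · rw [mul_apply, hW, h.map_swap]
  · have h1 := (h.commute_swap hW x).inv_left.eq
    have h2 := (h.commute_swap hW (x + a)).inv_left.eq
    calc W * s * W⁻¹ * swap x (x + κ) * swap (x + a) (x + a + κ)
        = W * s * (W⁻¹ * swap x (x + κ)) * swap (x + a) (x + a + κ) := by group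
      _ = W * s * swap x (x + κ) * (W⁻¹ * swap (x + a) (x + a + κ)) := by rw [h1]; group
      _ = W * s * swap x (x + κ) * swap (x + a) (x + a + κ) * W⁻¹ := by rw [h2]; group
      _ = _ := by
        rw [mul_inv_rev, swap_inv]
        simp only [mul_assoc]
        rw [swap_mul_self_mul]

/-- Transposing both pairs `{x, x + κ}` and `{y, y + κ}` preserves `IsConjMixed` if `x` and `y`
lie in the same coset of the subgroup generated by `a` and `κ`. -/
theorem IsConjMixed.mul_swap_mul_swap (h : IsPairing π κ)
    {p : Perm G} (hp : IsConjMixed π κ a b p) {x y : G} (j : ℕ) (hy : π y = π x + j • π a) :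
    IsConjMixed π κ a b (p * swap x (x + κ) * swap y (y + κ)) := by
  have key : ∀ j : ℕ, IsConjMixed π κ a b
      (p * swap x (x + κ) * swap (x + j • a) (x + j • a + κ)) := fun j => by
    induction j with
    | zero => simpa [mul_assoc] using hp
    | succ n ih =>
      have := ih.mul_swap_mul_swap_add h (x + n • a)
      rwa [mul_assoc _ (swap (x + n • a) _) (swap (x + n • a) _), swap_mul_self, mul_one,
        add_assoc x, ← succ_nsmul] at this
  rw [h.swap_congr (u := y) (v := x + j • a) (by rw [hy]; simp)]
  exact key j

/-- Conjugate to a mixed permutation by a permutation that maps each pair to itself, and such that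
every cycle contains a move by `b` or `b + κ`. The latter makes every cycle meet every coset of the
subgroup generated by `a` and `κ`. -/
def IsMergeable (π : G →+ H) (κ a b : G) (p : Perm G) : Prop :=
  IsConjMixed π κ a b p ∧ ∀ v, ∃ w, p.SameCycle v w ∧ π (p w) = π w + π b

variable [Finite G]

/-- If two transpositions of pairs in one coset both merge cycles, their composition with a
mergeable permutation is mergeable. -/
theorem IsMergeable.mul_swap_mul_swap (h : IsPairing π κ)
    {p : Perm G} (hp : IsMergeable π κ a b p) {x z : G} (j : ℕ) (hz : π z = π x + j • π a)
    (hx : ¬ p.SameCycle x (x + κ)) (hz' : ¬ (p * swap x (x + κ)).SameCycle z (z + κ)) :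
    IsMergeable π κ a b (p * swap x (x + κ) * swap z (z + κ)) := by
  have hq := hp.1.mul_swap_mul_swap h j hz
  refine ⟨hq, fun v => ?_⟩
  obtain ⟨w, hvw, hw⟩ := hp.2 v
  have hvw := (hvw.mul_swap hx).mul_swap hz'
  have hjoin : ∀ u, π w = π u →
      (p * swap x (x + κ) * swap z (z + κ)).SameCycle u (u + κ) →
      ∃ w, (p * swap x (x + κ) * swap z (z + κ)).SameCycle v w ∧
        π ((p * swap x (x + κ) * swap z (z + κ)) w) = π w + π b := fun u hu huu => by
    have hvu : (p * swap x (x + κ) * swap z (z + κ)).SameCycle v u := by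
      rcases (h.eq_iff w u).1 hu with rfl | rfl
      · exact hvw
      · exact hvw.trans huu.symm
    rcases hq.isMixedMod h u with ⟨-, h2⟩ | ⟨-, h2⟩
    · exact ⟨u + κ, hvu.trans huu, by rw [h2, h.map_add_eq]⟩
    · exact ⟨u, hvu, h2⟩
  by_cases hwx : π w = π x
  · exact hjoin x hwx ((sameCycle_mul_swap_self hx).mul_swap hz')
  by_cases hwz : π w = π z
  · exact hjoin z hwz (sameCycle_mul_swap_self hz')
  have hfix : ∀ u, π w ≠ π u → swap u (u + κ) w = w := fun u hu => by
    apply swap_apply_of_ne_of_ne <;> rintro rfl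
    · exact hu rfl
    · exact hu (h.map_add_eq u)
  exact ⟨w, hvw, by rw [mul_apply, mul_apply, hfix z hwz, hfix x hwx, hw]⟩

omit [DecidableEq G] [Finite G] in
theorem exists_nsmul_eq_zsmul [Finite H] (g : H) (j : ℤ) : ∃ m : ℕ, m • g = j • g := by
  have : j • g ∈ AddSubgroup.zmultiples g := ⟨j, rfl⟩
  rw [← mem_multiples_iff_mem_zmultiples] at this
  exact this

omit [DecidableEq G] in
/-- Every cycle enters the coset of `w + i • b` modulo the subgroup generated by `a` and `κ`. -/
theorem IsMergeable.exists_sameCycle {p : Perm G} (h : IsPairing π κ)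
    (hp : IsMergeable π κ a b p) (w : G) (i : ℕ) :
    ∃ z, p.SameCycle w z ∧ ∃ j : ℕ, π z = π w + i • π b + j • π a := by
  have hstep : ∀ w, ∃ z, p.SameCycle w z ∧ ∃ j : ℕ, π z = π w + π b + j • π a := fun w => by
    obtain ⟨w', hw, hb⟩ := hp.2 w
    obtain ⟨n, rfl⟩ := hw.exists_nat_pow_eq
    clear hw
    induction n generalizing w with
    | zero => exact ⟨p w, sameCycle_apply_self p w, 0, by simpa using hb⟩
    | succ n ih =>
      have hd : π (p w) = π w + π a ∨ π (p w) = π w + π b := by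
        rcases hp.1.isMixedMod h w with ⟨h1, -⟩ | ⟨-, h1⟩
        exacts [Or.inl h1, Or.inr h1]
      rcases hd with hd | hd
      · rw [pow_succ, mul_apply] at hb
        obtain ⟨z, hz, j, hj⟩ := ih (p w) hb
        exact ⟨z, (sameCycle_apply_self p w).trans hz, j + 1, by
          rw [hj, hd, succ_nsmul]; abel⟩
      · exact ⟨p w, sameCycle_apply_self p w, 0, by simpa using hd⟩
  induction i with
  | zero => exact ⟨w, SameCycle.refl _ _, 0, by simp⟩
  | succ n ih =>
    obtain ⟨z, hz, j, hj⟩ := ih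
    obtain ⟨z', hz', j', hj'⟩ := hstep z
    exact ⟨z', hz.trans hz', j + j', by rw [hj', hj, succ_nsmul, add_nsmul]; abel⟩

end Decidable

/-- If a permutation moves each pair to pairs in the directions `a` and `b`, and no pair meets two
cycles, then there is only one cycle. -/
theorem IsMixedMod.isTransitive (h : IsPairing π κ) {p : Perm G} (hp : IsMixedMod π κ a b p)
    (hgen : ∀ z : H, ∃ i j : ℕ, z = i • π b + j • π a)
    (hpair : ∀ x, p.SameCycle x (x + κ)) : p.IsTransitive := by
  have hcongr : ∀ {x y z}, p.SameCycle x y → π z = π y → p.SameCycle x z := by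
    intro x y z hxy hz
    rcases (h.eq_iff z y).1 hz with rfl | rfl
    · exact hxy
    · exact hxy.trans (hpair y)
  have hab : ∀ x z, (π z = π x + π a ∨ π z = π x + π b) → p.SameCycle x z := by
    intro x z hz
    have h1 := sameCycle_apply_self p x
    have h2 := (hpair x).trans (sameCycle_apply_self p (x + κ))
    rcases hp x with ⟨ha, hb⟩ | ⟨ha, hb⟩ <;> rcases hz with hz | hz
    · exact hcongr h1 (hz.trans ha.symm)
    · exact hcongr h2 (hz.trans hb.symm)
    · exact hcongr h2 (hz.trans ha.symm)
    · exact hcongr h1 (hz.trans hb.symm)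
  intro x y
  obtain ⟨i, j, hij⟩ := hgen (π y - π x)
  have hb : p.SameCycle x (x + i • b) := by
    clear hij
    induction i with
    | zero => simpa using SameCycle.refl p x
    | succ n ih => exact ih.trans (hab _ _ (Or.inr (by rw [succ_nsmul]; simp [add_assoc])))
  have ha : p.SameCycle (x + i • b) (x + i • b + j • a) := by
    clear hij
    induction j with
    | zero => simpa using SameCycle.refl p _
    | succ n ih => exact ih.trans (hab _ _ (Or.inl (by rw [succ_nsmul]; simp [add_assoc])))
  refine hcongr (hb.trans ha) ?_
  rw [sub_eq_iff_eq_add] at hij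
  rw [hij]
  simp only [map_add, map_nsmul]
  abel

/-- If the mixed permutations are odd, then a mergeable permutation with as few cycles as possible
has only one cycle. -/
theorem exists_isMixed_isTransitive [Fintype G] [DecidableEq G] [Finite H] (h : IsPairing π κ)
    (hcard : Even (Fintype.card G))
    (hgen : ∀ z : H, ∃ i j : ℕ, z = i • π b + j • π a)
    (hsign : ∀ s : Perm G, IsMixed π κ a b s → sign s = -1)
    (hex : ∃ p, IsMergeable π κ a b p) :
    ∃ s : Perm G, IsMixed π κ a b s ∧ s.IsTransitive := by
  obtain ⟨p, hp, hmax⟩ := exists_maximal_sameCycle (F := {p | IsMergeable π κ a b p}) hex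
  have hp : IsMergeable π κ a b p := hp
  have hmod := hp.1.isMixedMod h
  have hodd : sign p = -1 := by
    obtain ⟨W, s, -, hs, rfl⟩ := hp.1
    rw [Perm.sign_mul, Perm.sign_mul, sign_inv, mul_right_comm, Int.units_mul_self, one_mul,
      hsign s hs]
  suffices hpt : p.IsTransitive by
    obtain ⟨W, s, -, hs, rfl⟩ := hp.1
    refine ⟨s, hs, fun x y => ?_⟩
    have := hpt (W x) (W y)
    simpa [sameCycle_conj] using this
  refine hmod.isTransitive h hgen fun x => ?_
  by_contra hx
  obtain ⟨w₀, hw₀x, hw₀x'⟩ := exists_third_cycle hcard hodd hx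
  -- a pair that meets the third cycle, in the coset of `x`, lies on it
  have hunsplit : ∀ z, p.SameCycle w₀ z → (∃ j : ℤ, π z = π x + j • π a) →
      p.SameCycle z (z + κ) := by
    rintro z hz ⟨j, hj⟩
    by_contra hzz
    obtain ⟨m, hm⟩ := exists_nsmul_eq_zsmul (π a) j
    have hz' : ¬ (p * swap x (x + κ)).SameCycle z (z + κ) := by
      intro hn
      rcases hn.of_mul_swap with hn | ⟨hn | hn, -⟩
      · exact hzz hn
      · exact hw₀x (hz.trans hn.symm)
      · exact hw₀x' (hz.trans hn.symm)
    refine hzz (hmax _ (hp.mul_swap_mul_swap h m (by rw [hm, hj]) hx hz')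
      (fun u v huv => (huv.mul_swap hx).mul_swap hz') _ _ (sameCycle_mul_swap_self hz'))
  obtain ⟨i, j, hij⟩ := hgen (π x - π w₀)
  obtain ⟨z, hz, j', hj'⟩ := hp.exists_sameCycle h w₀ i
  have hzx : π z = π x + ((j' : ℤ) - j) • π a := by
    rw [sub_eq_iff_eq_add] at hij
    rw [hj', hij, sub_smul, natCast_zsmul, natCast_zsmul]
    abel
  have hwalk : ∀ m : ℕ, ∃ y, p.SameCycle w₀ y ∧ π y = π z + m • π a := by
    intro m
    induction m with
    | zero => exact ⟨z, hz, by simp⟩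
    | succ n ih =>
      obtain ⟨y, hy, hyz⟩ := ih
      have hyy := hunsplit y hy ⟨(n : ℤ) + (j' - j), by
        rw [hyz, hzx, add_smul, natCast_zsmul]; abel⟩
      rcases hmod y with ⟨h1, -⟩ | ⟨h1, -⟩
      · exact ⟨p y, hy.trans (sameCycle_apply_self p y), by rw [h1, hyz, succ_nsmul]; abel⟩
      · exact ⟨p (y + κ), (hy.trans hyy).trans (sameCycle_apply_self p _), by
          rw [h1, hyz, succ_nsmul]; abel⟩
  obtain ⟨m, hm⟩ := exists_nsmul_eq_zsmul (π a) ((j : ℤ) - j')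
  obtain ⟨y, hy, hyz⟩ := hwalk m
  have hyx : π y = π x := by
    rw [hyz, hm, hzx, add_assoc, ← add_smul]; simp
  rcases (h.eq_iff y x).1 hyx with rfl | rfl
  · exact hw₀x hy
  · exact hw₀x' hy

end Mixed

/-! ### The sign of a mixed permutation -/

section Sign

open Equiv Equiv.Perm

variable {G H : Type*} [AddCommGroup G] [AddCommGroup H] {π : G →+ H} {κ a b : G}

/-- A mixed permutation followed by the translation by `-a` fixes the vertices that are moved by
`a`, and permutes the other ones cyclically if `b - a` generates the quotient. -/
theorem IsMixed.sign_eq [Fintype G] [DecidableEq G] [Fintype H] (h : IsPairing π κ) {s : Perm G}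
    (hs : IsMixed π κ a b s) [Nontrivial H] (hgen : ∀ z : H, ∃ j : ℕ, z = j • (π b - π a)) :
    sign s = sign (Equiv.addRight a) * -(-1) ^ Fintype.card H := by
  have hab : π b ≠ π a := by
    intro hab
    obtain ⟨z, hz⟩ := exists_ne (0 : H)
    obtain ⟨j, hj⟩ := hgen z
    exact hz (by simpa [hab] using hj)
  set r : Perm G := (Equiv.addRight a)⁻¹ * s with hr
  have hrv : ∀ v, r v = s v - a := fun v => by
    simp [hr, sub_eq_add_neg]
  have hmove : ∀ v, r v ≠ v ↔ π (s v) = π v + π b := by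
    intro v
    rw [hrv, Ne, sub_eq_iff_eq_add]
    refine ⟨fun hv => ?_, fun hv hn => hab ?_⟩
    · rcases hs v with ⟨h1, -⟩ | ⟨-, h1⟩
      exacts [absurd h1 hv, h1]
    · rw [hn, map_add] at hv
      exact (add_left_cancel hv).symm
  have hpair : ∀ v, r (v + κ) ≠ v + κ ↔ r v = v := by
    intro v
    rcases hs v with ⟨h1, h2⟩ | ⟨h1, h2⟩
    · have : r v = v := by rw [hrv, h1, add_sub_cancel_right]
      simp only [this, iff_true]
      exact (hmove _).2 (by rw [h2, h.map_add_eq])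
    · have h3 : r (v + κ) = v + κ := by rw [hrv, h1, add_sub_cancel_right]
      simp only [h3, ne_eq, not_true_eq_false, false_iff]
      exact (hmove v).2 h2
  have hinj : ∀ u v, r u ≠ u → r v ≠ v → π u = π v → u = v := by
    intro u v hu hv huv
    by_contra hne
    rw [h.eq_add_of_ne huv hne] at hu
    exact hv ((hpair v).1 hu)
  have hstep : ∀ v, r v ≠ v → π (r v) = π v + (π b - π a) := fun v hv => by
    rw [hrv, map_sub, (hmove v).1 hv, add_sub_assoc]
  have hpow : ∀ v, r v ≠ v → ∀ j : ℕ, r ((r ^ j) v) ≠ (r ^ j) v ∧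
      π ((r ^ j) v) = π v + j • (π b - π a) := by
    intro v hv j
    induction j with
    | zero => simpa using hv
    | succ n ih =>
      rw [pow_succ', mul_apply]
      exact ⟨fun hn => ih.1 (r.injective hn), by
        rw [mul_apply, hstep _ ih.1, ih.2, succ_nsmul, add_assoc]⟩
  obtain ⟨v, hv⟩ : ∃ v, r v ≠ v := by
    by_cases h0 : r 0 = 0
    · exact ⟨0 + κ, (hpair 0).2 h0⟩
    · exact ⟨0, h0⟩
  have hcycle : r.IsCycle := by
    refine ⟨v, hv, fun w hw => ?_⟩
    obtain ⟨j, hj⟩ := hgen (π w - π v)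
    refine ⟨j, ?_⟩
    rw [zpow_natCast]
    refine hinj _ _ (hpow v hv j).1 hw ?_
    rw [(hpow v hv j).2, ← hj]; abel
  have hcard : r.support.card = Fintype.card H := by
    rw [← Finset.card_univ]
    refine Finset.card_bij (fun w _ => π w) (fun _ _ => Finset.mem_univ _)
      (fun u hu w hw huw => hinj u w (mem_support.1 hu) (mem_support.1 hw) huw) fun z _ => ?_
    obtain ⟨j, hj⟩ := hgen (z - π v)
    refine ⟨(r ^ j) v, mem_support.2 (hpow v hv j).1, ?_⟩
    rw [(hpow v hv j).2, ← hj]; abel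
  rw [show s = Equiv.addRight a * r by rw [hr, mul_inv_cancel_left], Perm.sign_mul, hcycle.sign,
    hcard]

end Sign

/-! ### Constructing mixed permutations -/

section Construction

open Equiv Equiv.Perm

variable {G H : Type*} [AddCommGroup G] [AddCommGroup H] {π : G →+ H} {κ a b : G}

open scoped Classical in
/-- For a set `T` that contains exactly one vertex of each pair, the mixed permutation that moves
the elements of `T` by `a`. The image of any other vertex is the one of `v + b` and `v + b + κ`
that is not in `T + a`. -/
noncomputable def mixedMap (κ a b : G) (T : Set G) (v : G) : G :=
  if v ∈ T then v + a else if v + b - a ∈ T then v + b + κ else v + b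

theorem mixedMap_of_mem {T : Set G} {v : G} (hv : v ∈ T) : mixedMap κ a b T v = v + a :=
  if_pos hv

theorem map_mixedMap_of_notMem (h : IsPairing π κ) {T : Set G} {v : G} (hv : v ∉ T) :
    π (mixedMap κ a b T v) = π v + π b := by
  rw [mixedMap, if_neg hv]
  split_ifs
  · rw [h.map_add_eq, map_add]
  · rw [map_add]

theorem isMixed_mixedMap (h : IsPairing π κ) {T : Set G} (hT : ∀ v, v + κ ∈ T ↔ v ∉ T) :
    IsMixed π κ a b (mixedMap κ a b T) := by
  intro v
  by_cases hv : v ∈ T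
  · exact Or.inl ⟨mixedMap_of_mem hv, by
      rw [map_mixedMap_of_notMem h (fun hn => (hT v).1 hn hv), h.map_add_eq]⟩
  · exact Or.inr ⟨mixedMap_of_mem ((hT v).2 hv), map_mixedMap_of_notMem h hv⟩

theorem mixedMap_injective (h : IsPairing π κ) {T : Set G} (hT : ∀ v, v + κ ∈ T ↔ v ∉ T) :
    Function.Injective (mixedMap κ a b T) := by
  have hmem : ∀ v, mixedMap κ a b T v - a ∈ T ↔ v ∈ T := by
    intro v
    by_cases hv : v ∈ T
    · simp [mixedMap_of_mem, hv]
    · simp only [mixedMap, hv, if_false, iff_false]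
      split_ifs with h1
      · rw [add_sub_right_comm, hT]
        simpa using h1
      · exact h1
  intro u v huv
  have huv' : u ∈ T ↔ v ∈ T := by rw [← hmem u, huv, hmem]
  by_cases hu : u ∈ T
  · rw [mixedMap_of_mem hu, mixedMap_of_mem (huv'.1 hu)] at huv
    exact add_right_cancel huv
  · have hv : v ∉ T := fun hv => hu (huv'.2 hv)
    have hπ : π u = π v := by
      have := congrArg π huv
      rwa [map_mixedMap_of_notMem h hu, map_mixedMap_of_notMem h hv, add_left_inj] at this
    by_contra hne
    rw [h.eq_add_of_ne hπ hne, hT] at hu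
    exact hu hv

/-- If `T` contains no coset of the subgroup generated by `a`, then no cycle of the mixed permutation
given by `T` consists of moves by `a` only. -/
theorem exists_isMergeable [Finite G] (h : IsPairing π κ) {T : Set G}
    (hT : ∀ v, v + κ ∈ T ↔ v ∉ T) (hTa : ∀ v, ∃ j : ℕ, v + j • a ∉ T) :
    ∃ p, IsMergeable π κ a b p := by
  let s : Perm G := Equiv.ofBijective _ (Finite.injective_iff_bijective.1
    (mixedMap_injective (a := a) (b := b) h hT))
  have hs : ∀ v, s v = mixedMap κ a b T v := fun _ => rfl
  refine ⟨s, ⟨1, s, fun _ => rfl, isMixed_mixedMap h hT, by simp⟩, fun v => ?_⟩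
  by_contra! hv
  have hmem : ∀ w, s.SameCycle v w → w ∈ T := fun w hw => by
    by_contra hwT
    exact hv w hw (by rw [hs, map_mixedMap_of_notMem h hwT])
  have hpow : ∀ j : ℕ, s.SameCycle v (v + j • a) := by
    intro j
    induction j with
    | zero => simpa using SameCycle.refl s v
    | succ n ih =>
      refine ih.trans ⟨1, ?_⟩
      rw [zpow_one, hs, mixedMap_of_mem (hmem _ ih), succ_nsmul, add_assoc]
  obtain ⟨j, hj⟩ := hTa v
  exact hj (hmem _ (hpow j))

end Construction

/-! ### Layered permutations: merging cycles one pair at a time -/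

section Layered

open Equiv Equiv.Perm

variable {G H L : Type*} [AddCommGroup G] [AddCommGroup H] [AddCommGroup L]
  {π : G →+ H} {l : G →+ L} {κ a b : G}

/-- With respect to the levels `l v`, the map `s` moves the vertices of level `0` by `b` or
`b + κ`, it is mixed on the vertices of level `l a`, and it moves all other vertices by `a`. -/
structure IsLayered (π : G →+ H) (l : G →+ L) (κ a b : G) (s : G → G) : Prop where
  zero : ∀ v, l v = 0 → π (s v) = π v + π b
  one : ∀ v, l v = l a → (s v = v + a ∧ π (s (v + κ)) = π v + π b) ∨
    (s (v + κ) = v + κ + a ∧ π (s v) = π v + π b)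
  other : ∀ v, l v ≠ 0 → l v ≠ l a → s v = v + a

theorem IsLayered.eq_or {s : G → G} (hs : IsLayered π l κ a b s) (v : G) :
    s v = v + a ∨ π (s v) = π v + π b := by
  by_cases h0 : l v = 0
  · exact Or.inr (hs.zero v h0)
  by_cases h1 : l v = l a
  · rcases hs.one v h1 with ⟨h2, -⟩ | ⟨-, h2⟩
    exacts [Or.inl h2, Or.inr h2]
  · exact Or.inl (hs.other v h0 h1)

theorem level_of_map_eq (h : IsPairing π κ) (hκ : l κ = 0) {u v : G} (huv : π u = π v) :
    l u = l v := by
  rcases (h.eq_iff u v).1 huv with rfl | rfl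
  · rfl
  · rw [map_add, hκ, add_zero]

theorem IsLayered.level (h : IsPairing π κ) (hκ : l κ = 0) (hab : l a = l b) {s : G → G}
    (hs : IsLayered π l κ a b s) (v : G) : l (s v) = l v + l a := by
  rcases hs.eq_or v with h1 | h1
  · rw [h1, map_add]
  · rw [level_of_map_eq (l := l) h hκ (h1.trans (map_add π v b).symm), map_add, hab]

theorem exists_isLayered [Finite G] (h : IsPairing π κ) (hκ : l κ = 0) (hab : l a = l b)
    (ha : l a ≠ 0) {T : Set G} (hT : ∀ v, v + κ ∈ T ↔ v ∉ T) :
    ∃ s : Perm G, IsLayered π l κ a b s := by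
  classical
  let f : G → G := fun v => if l v = 0 then v + b else if l v = l a then mixedMap κ a b T v
    else v + a
  have hf : IsLayered π l κ a b f := by
    refine ⟨fun v hv => ?_, fun v hv => ?_, fun v h0 h1 => ?_⟩
    · simp [f, hv]
    · have h2 : l (v + κ) = l a := by rw [map_add, hκ, add_zero, hv]
      simpa only [f, h2, hv, ha, if_true, if_false] using isMixed_mixedMap h hT v
    · simp only [f, h0, h1, if_false]
  have hinj : Function.Injective f := by
    intro u v huv
    have hl : l u = l v := by
      have := congrArg l huv
      rwa [hf.level h hκ hab, hf.level h hκ hab, add_left_inj] at this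
    simp only [f, hl] at huv
    split_ifs at huv
    · exact add_right_cancel huv
    · exact mixedMap_injective h hT huv
    · exact add_right_cancel huv
  exact ⟨Equiv.ofBijective f (Finite.injective_iff_bijective.1 hinj), hf⟩

/-- Level `0` pairs may be transposed freely, since both vertices move by `b` or `b + κ`. -/
theorem IsLayered.mul_swap [DecidableEq G] (h : IsPairing π κ) (hκ : l κ = 0) (ha : l a ≠ 0)
    {s : Perm G} (hs : IsLayered π l κ a b s) {x : G} (hx : l x = 0) :
    IsLayered π l κ a b (s * swap x (x + κ) : Perm G) := by
  have hfix : ∀ v, l v ≠ 0 → swap x (x + κ) v = v := fun v hv => by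
    apply swap_apply_of_ne_of_ne <;> rintro rfl
    · exact hv hx
    · exact hv (by rw [map_add, hx, hκ, add_zero])
  refine ⟨fun v hv => ?_, fun v hv => ?_, fun v h0 h1 => ?_⟩
  · rw [mul_apply, hs.zero, h.map_swap]
    rw [level_of_map_eq h hκ (h.map_swap x v), hv]
  · have h1 : l v ≠ 0 := by rwa [hv]
    have h2 : l (v + κ) ≠ 0 := by rwa [map_add, hκ, add_zero]
    rw [mul_apply, mul_apply, hfix v h1, hfix _ h2]
    exact hs.one v hv
  · rw [mul_apply, hfix v h0, hs.other v h0 h1]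

/-- A layered permutation has only one cycle if no pair of level `0` meets two cycles: the first
return to level `0` then joins `y` to `y + (b - a)` for every `y` of level `0`. -/
theorem IsLayered.isTransitive [Finite L] (h : IsPairing π κ) (hκ : l κ = 0) (hab : l a = l b)
    (ha : l a ≠ 0) (hL : ∀ z : L, ∃ j : ℕ, z + j • l a = 0)
    (hgen : ∀ v, l v = 0 → ∃ j : ℕ, π v = j • (π b - π a))
    {s : Perm G} (hs : IsLayered π l κ a b s)
    (hpair : ∀ x, l x = 0 → s.SameCycle x (x + κ)) : s.IsTransitive := by
  set n := addOrderOf (l a) with hn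
  have hn2 : 2 ≤ n := by
    have h0 : 0 < n := addOrderOf_pos (l a)
    have h1 : n ≠ 1 := fun h1 => ha (AddMonoid.addOrderOf_eq_one_iff.1 h1)
    omega
  have hcongr : ∀ {x y z}, l y = 0 → s.SameCycle x y → π z = π y → s.SameCycle x z := by
    intro x y z hy hxy hz
    rcases (h.eq_iff z y).1 hz with rfl | rfl
    · exact hxy
    · exact hxy.trans (hpair y hy)
  -- from level `2 • l a` the permutation follows `a` all the way to level `0`
  have hwalk : ∀ v, l v = 2 • l a → ∀ i : ℕ, i + 2 ≤ n → s.SameCycle v (v + i • a) := by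
    intro v hv i
    induction i with
    | zero => intro _; simpa using SameCycle.refl s v
    | succ i ih =>
      intro hi
      have hl : l (v + i • a) = (i + 2) • l a := by
        rw [map_add, hv, map_nsmul, ← add_nsmul, add_comm]
      have hl0 : l (v + i • a) ≠ 0 := by
        rw [hl]
        exact fun h0 => absurd (addOrderOf_le_of_nsmul_eq_zero (by omega) h0) (by omega)
      have hl1 : l (v + i • a) ≠ l a := by
        rw [hl, show i + 2 = (i + 1) + 1 from rfl, succ_nsmul, Ne, add_eq_right]
        exact fun h0 => absurd (addOrderOf_le_of_nsmul_eq_zero (by omega) h0) (by omega)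
      refine (ih (by omega)).trans ⟨1, ?_⟩
      rw [zpow_one, hs.other _ hl0 hl1, succ_nsmul, add_assoc]
  have hna : n • l a = 0 := addOrderOf_nsmul_eq_zero _
  have hstep : ∀ y z, l y = 0 → π z = π y + (π b - π a) → s.SameCycle y z := by
    intro y z hy hz
    obtain ⟨m, hm⟩ : ∃ m, n = m + 2 := ⟨n - 2, by omega⟩
    -- the vertex of level `0` whose pair returns to the pairs of `y` and `z`
    set x := y - b - a - m • a with hx
    have hlx : l x = 0 := by
      have : m • l a + l a + l a = 0 := by rw [← succ_nsmul, ← succ_nsmul, ← hna, hm]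
      calc l x = -(m • l a + l a + l a) := by
            rw [hx, map_sub, map_sub, map_sub, hy, ← hab, map_nsmul]; abel
        _ = 0 := by rw [this, neg_zero]
    have hx1 : l (s x) = l a := by rw [hs.level h hκ hab, hlx, zero_add]
    have hxκ : s (x + κ) = s x + κ := by
      refine h.eq_add_of_ne ?_ fun hn => h.add_ne x (s.injective hn)
      rw [hs.zero x hlx, hs.zero _ (by rw [map_add, hlx, hκ, add_zero]), h.map_add_eq]
    have hc : ∀ i j, i = s x ∨ i = s x + κ → s i = j → s.SameCycle x j := by
      rintro i j (rfl | rfl) rfl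
      · exact (sameCycle_apply_self s x).trans (sameCycle_apply_self s _)
      · rw [← hxκ]
        exact ((hpair x hlx).trans (sameCycle_apply_self s _)).trans (sameCycle_apply_self s _)
    obtain ⟨u, w, hu, hw, hua, hwb⟩ : ∃ u w, s.SameCycle x u ∧ s.SameCycle x w ∧
        π u = π x + π b + π a ∧ π w = π x + π b + π b := by
      have h0 := hs.zero x hlx
      rcases hs.one (s x) hx1 with ⟨h1, h2⟩ | ⟨h1, h2⟩
      · exact ⟨_, _, hc _ _ (Or.inl rfl) rfl, hc _ _ (Or.inr rfl) rfl,
          by rw [h1, map_add, h0], by rw [h2, h0]⟩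
      · exact ⟨_, _, hc _ _ (Or.inr rfl) rfl, hc _ _ (Or.inl rfl) rfl,
          by rw [h1, map_add, h.map_add_eq, h0], by rw [h2, h0]⟩
    have hlu : l u = 2 • l a := by
      rw [level_of_map_eq (l := l) (v := x + b + a) h hκ (by simp [hua]), map_add, map_add, hlx,
        ← hab, two_nsmul, zero_add]
    have hlw : l w = 2 • l a := by
      rw [level_of_map_eq (l := l) (v := x + b + b) h hκ (by simp [hwb]), map_add, map_add, hlx,
        ← hab, two_nsmul, zero_add]
    have hu' := hu.trans (hwalk u hlu m (by omega))
    have hw' := hw.trans (hwalk w hlw m (by omega))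
    have hl0 : ∀ {v}, l v = 2 • l a → l (v + m • a) = 0 := fun hv => by
      rw [map_add, hv, map_nsmul, ← add_nsmul, ← hna, hm, add_comm]
    have hxy := hcongr (z := y) (hl0 hlu) hu' (by
      rw [map_add, hua, hx]; simp only [map_sub, map_nsmul]; abel)
    have hxz := hcongr (z := z) (hl0 hlw) hw' (by
      rw [hz, map_add, hwb, hx]; simp only [map_sub, map_nsmul]; abel)
    exact hxy.symm.trans hxz
  have hpow : ∀ j : ℕ, s.SameCycle 0 (j • (b - a)) := by
    intro j
    induction j with
    | zero => simpa using SameCycle.refl s 0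
    | succ j ih =>
      refine ih.trans (hstep _ _ ?_ ?_)
      · simp [hab]
      · rw [succ_nsmul]; simp
  have hzero : ∀ v, l v = 0 → s.SameCycle 0 v := by
    intro v hv
    obtain ⟨j, hj⟩ := hgen v hv
    exact hcongr (by simp [hab]) (hpow j) (by rw [hj]; simp)
  have hlevel : ∀ (v : G) (j : ℕ), l ((s ^ j) v) = l v + j • l a := by
    intro v j
    induction j with
    | zero => simp
    | succ j ih => rw [pow_succ', mul_apply, hs.level h hκ hab, ih, succ_nsmul, add_assoc]
  have hall : ∀ v, s.SameCycle 0 v := by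
    intro v
    obtain ⟨j, hj⟩ := hL (l v)
    have := hzero ((s ^ j) v) (by rw [hlevel, hj])
    exact this.trans (SameCycle.symm ⟨j, by simp⟩)
  exact fun x y => (hall x).symm.trans (hall y)

/-- A layered permutation with as few cycles as possible has only one cycle. -/
theorem exists_isLayered_isTransitive [Finite G] [Finite L] (h : IsPairing π κ)
    (hκ : l κ = 0) (hab : l a = l b) (ha : l a ≠ 0) (hL : ∀ z : L, ∃ j : ℕ, z + j • l a = 0)
    (hgen : ∀ v, l v = 0 → ∃ j : ℕ, π v = j • (π b - π a))
    {T : Set G} (hT : ∀ v, v + κ ∈ T ↔ v ∉ T) :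
    ∃ s : Perm G, IsLayered π l κ a b s ∧ s.IsTransitive := by
  classical
  obtain ⟨s₀, hs₀⟩ := exists_isLayered (b := b) h hκ hab ha hT
  obtain ⟨s, hs, hmax⟩ := exists_maximal_sameCycle
    (F := {s : Perm G | IsLayered π l κ a b s}) ⟨s₀, hs₀⟩
  refine ⟨s, hs, IsLayered.isTransitive h hκ hab ha hL hgen hs fun x hx => ?_⟩
  by_contra hxx
  exact hxx (hmax _ (IsLayered.mul_swap h hκ ha hs hx) (fun u v huv => huv.mul_swap hxx) _ _
    (sameCycle_mul_swap_self hxx))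

end Layered

/-! ### Permutations when `b - a` generates the quotient -/

section Trichotomy

open Equiv Equiv.Perm

variable {G H : Type*} [AddCommGroup G] [AddCommGroup H] {π : G →+ H} {κ a b : G}

/-- A pair has at most two preimages. -/
theorem IsPairing.not_three_images (h : IsPairing π κ) {s : Perm G} {x y z : G} (hxy : x ≠ y)
    (hxz : x ≠ z) (hyz : y ≠ z) (h1 : π (s x) = π (s y)) (h2 : π (s x) = π (s z)) : False := by
  have hy := h.eq_add_of_ne h1 (s.injective.ne hxy)
  have hz := h.eq_add_of_ne h2 (s.injective.ne hxz)
  exact hyz (s.injective (add_right_cancel (hy.symm.trans hz)))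

/-- If `b - a` generates the quotient, then the number of vertices moved by `a` is the same for all
pairs. According as this number is `2`, `0` or `1`, the permutation is a translation, moves
everything by `b` or `b + κ`, or is mixed. -/
theorem IsPairing.trichotomy (h : IsPairing π κ) (hab : π a ≠ π b)
    (hgen : ∀ z : H, ∃ j : ℕ, z = j • (π b - π a)) {s : Perm G}
    (hs : ∀ v, s v = v + a ∨ π (s v) = π v + π b) :
    (∀ v, s v = v + a) ∨ (∀ v, π (s v) = π v + π b) ∨ IsMixed π κ a b s := by
  classical
  let f : G → ℕ := fun v => (if s v = v + a then 1 else 0) + if s (v + κ) = v + κ + a then 1 else 0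
  have hfκ : ∀ u v, π u = π v → f u = f v := by
    intro u v huv
    rcases (h.eq_iff u v).1 huv with rfl | rfl
    · rfl
    · simp only [f, h.add_add]; exact add_comm _ _
  -- at most two vertices are mapped to the pair of `v + a`
  have hle : ∀ v w, π w = π v + π a - π b → f v ≤ f w := by
    intro v w hw
    have hne : π w ≠ π v := by
      rw [hw, add_sub_assoc, Ne, add_eq_left, sub_eq_zero]; exact hab
    have n1 : v ≠ w := fun hn => hne (by rw [hn])
    have n2 : v ≠ w + κ := fun hn => hne (by rw [hn, h.map_add_eq])
    have n3 : v + κ ≠ w := fun hn => hne (by rw [← hn, h.map_add_eq])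
    have n4 : v + κ ≠ w + κ := fun hn => n1 (add_right_cancel hn)
    have n5 := (h.add_ne v).symm
    have n6 := (h.add_ne w).symm
    have ha : ∀ u, π u = π v → s u = u + a → π (s u) = π v + π a := fun u hu hsu => by
      rw [hsu, map_add, hu]
    have hb : ∀ u, π u = π w → s u ≠ u + a → π (s u) = π v + π a := fun u hu hsu => by
      rw [(hs u).resolve_left hsu, hu, hw, sub_add_cancel]
    have hvκ := h.map_add_eq v
    have hwκ := h.map_add_eq w
    by_contra hlt
    simp only [f] at hlt
    by_cases h1 : s v = v + a <;> by_cases h2 : s (v + κ) = v + κ + a <;>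
      by_cases h3 : s w = w + a <;> by_cases h4 : s (w + κ) = w + κ + a <;>
      simp only [h1, h2, h3, h4, if_true, if_false] at hlt <;> try omega
    · exact h.not_three_images n5 n2 n4 ((ha v rfl h1).trans (ha _ hvκ h2).symm)
        ((ha v rfl h1).trans (hb _ hwκ h4).symm)
    · exact h.not_three_images n5 n1 n3 ((ha v rfl h1).trans (ha _ hvκ h2).symm)
        ((ha v rfl h1).trans (hb _ rfl h3).symm)
    · exact h.not_three_images n5 n1 n3 ((ha v rfl h1).trans (ha _ hvκ h2).symm)
        ((ha v rfl h1).trans (hb _ rfl h3).symm)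
    · exact h.not_three_images n1 n2 n6 ((ha v rfl h1).trans (hb _ rfl h3).symm)
        ((ha v rfl h1).trans (hb _ hwκ h4).symm)
    · exact h.not_three_images n3 n4 n6 ((ha _ hvκ h2).trans (hb _ rfl h3).symm)
        ((ha _ hvκ h2).trans (hb _ hwκ h4).symm)
  have hconst : ∀ v w, f w ≤ f v := by
    intro v w
    obtain ⟨j, hj⟩ := hgen (π w - π v)
    rw [sub_eq_iff_eq_add] at hj
    induction j generalizing w with
    | zero => exact (hfκ w v (by simpa using hj)).le
    | succ n ih =>
      refine (hle w (w + a - b) (by simp)).trans (ih _ ?_)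
      rw [map_sub, map_add, hj, succ_nsmul]; abel
  have hf : ∀ v, f v = f 0 := fun v => le_antisymm (hconst 0 v) (hconst v 0)
  by_cases h1 : s 0 = 0 + a <;> by_cases h2 : s (0 + κ) = 0 + κ + a
  · refine Or.inl fun v => ?_
    have := hf v
    by_contra hv
    simp only [f, h1, h2, hv, if_true, if_false] at this
    split_ifs at this <;> omega
  · refine Or.inr (Or.inr fun v => ?_)
    have := hf v
    simp only [f, h1, h2, if_true, if_false] at this
    split_ifs at this with h3 h4 h4
    · omega
    · exact Or.inl ⟨h3, by rw [(hs _).resolve_left h4, h.map_add_eq]⟩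
    · exact Or.inr ⟨h4, (hs _).resolve_left h3⟩
    · omega
  · refine Or.inr (Or.inr fun v => ?_)
    have := hf v
    simp only [f, h1, h2, if_true, if_false] at this
    split_ifs at this with h3 h4 h4
    · omega
    · exact Or.inl ⟨h3, by rw [(hs _).resolve_left h4, h.map_add_eq]⟩
    · exact Or.inr ⟨h4, (hs _).resolve_left h3⟩
    · omega
  · refine Or.inr (Or.inl fun v => (hs v).resolve_left fun hv => ?_)
    have := hf v
    simp only [f, h1, h2, hv, if_true, if_false] at this
    split_ifs at this <;> omega

end Trichotomy

/-! ### Hamiltonian circuits as permutations, and reduction modulo `k` -/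

section Circulant

open Equiv Equiv.Perm

/-- The hamiltonian circuits of a digraph on `ZMod n` correspond to the permutations with a single
cycle that map every vertex to one of its out-neighbours. -/
theorem hasHamiltonianCircuit_iff {n : ℕ} [NeZero n] (D : Digraph (ZMod n)) :
    D.HasHamiltonianCircuit ↔ ∃ s : Perm (ZMod n), (∀ v, D.Adj v (s v)) ∧ s.IsTransitive := by
  constructor
  · rintro ⟨m, hm, c, hc, hadj⟩
    have : NeZero m := ⟨hm.ne'⟩
    let e := Equiv.ofBijective c hc
    have he : ∀ i, (e.permCongr (Equiv.addRight 1)) (c i) = c (i + 1) := fun i => by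
      simp only [Equiv.permCongr_apply]
      change e (Equiv.addRight 1 (e.symm (e i))) = e (i + 1)
      simp
    refine ⟨e.permCongr (Equiv.addRight 1), fun v => ?_, fun x y => ?_⟩
    · obtain ⟨i, rfl⟩ := hc.2 v
      rw [he]; exact hadj i
    · have key : ∀ (i : ZMod m) (j : ℕ),
          (e.permCongr (Equiv.addRight 1)).SameCycle (c i) (c (i + j)) := by
        intro i j
        induction j with
        | zero => simpa using SameCycle.refl _ _
        | succ j ih =>
          refine ih.trans ⟨1, ?_⟩
          rw [zpow_one, he, Nat.cast_succ, add_assoc]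
      obtain ⟨i, rfl⟩ := hc.2 x
      obtain ⟨j, rfl⟩ := hc.2 y
      have := key i (j - i).val
      rwa [ZMod.natCast_zmod_val, add_sub_cancel] at this
  · rintro ⟨s, hs, ht⟩
    have hcyc : s.IsCycleOn ((Finset.univ : Finset (ZMod n)) : Set (ZMod n)) := by
      simpa using ht.isCycleOn
    have hmod : ∀ i j : ℕ, (s ^ i) 0 = (s ^ j) 0 ↔ i ≡ j [MOD n] := fun i j => by
      rw [hcyc.pow_apply_eq_pow_apply (Finset.mem_univ 0), Finset.card_univ, ZMod.card]
    refine ⟨n, NeZero.pos n, fun i => (s ^ i.val) 0,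
      Finite.injective_iff_bijective.1 fun i j hij => ?_, fun i => ?_⟩
    · have := (hmod _ _).1 hij
      rw [← ZMod.natCast_eq_natCast_iff] at this
      simpa using this
    · have : (s ^ (i + 1).val) 0 = (s ^ (i.val + 1)) 0 := by
        rw [hmod, ← ZMod.natCast_eq_natCast_iff]
        simp
      change D.Adj _ ((s ^ (i + 1).val) 0)
      rw [this, pow_succ', mul_apply]
      exact hs _

variable {k : ℕ}

/-- The reduction modulo `k` of the residues modulo `2 * k`. -/
abbrev modHalf (k : ℕ) : ZMod (2 * k) →+ ZMod k :=
  (ZMod.castHom (dvd_mul_left k 2) (ZMod k)).toAddMonoidHom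

theorem modHalf_intCast (k : ℕ) (z : ℤ) : modHalf k (z : ZMod (2 * k)) = z := by
  simp [modHalf]

theorem isPairing_modHalf [NeZero k] : IsPairing (modHalf k) (k : ZMod (2 * k)) where
  eq_iff u v := by
    obtain ⟨u, rfl⟩ := ZMod.intCast_surjective u
    obtain ⟨v, rfl⟩ := ZMod.intCast_surjective v
    rw [modHalf_intCast, modHalf_intCast, ZMod.intCast_eq_intCast_iff_dvd_sub,
      show (k : ZMod (2 * k)) = ((k : ℤ) : ZMod (2 * k)) by simp, ← Int.cast_add,
      ZMod.intCast_eq_intCast_iff_dvd_sub, ZMod.intCast_eq_intCast_iff_dvd_sub]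
    push_cast
    constructor
    · rintro ⟨m, hm⟩
      rcases Int.even_or_odd' m with ⟨q, rfl | rfl⟩
      · exact Or.inl ⟨q, by rw [hm]; ring⟩
      · exact Or.inr ⟨q + 1, by linear_combination hm⟩
    · rintro (⟨q, hq⟩ | ⟨q, hq⟩)
      · exact ⟨2 * q, by rw [hq]; ring⟩
      · exact ⟨2 * q - 1, by linear_combination hq⟩
  ne_zero := by
    rw [Ne, ZMod.natCast_eq_zero_iff]
    intro hd
    have := Nat.le_of_dvd (NeZero.pos k) hd
    have := NeZero.pos k
    omega

/-- The residues in `[0, k)` form a transversal of the pairs `{v, v + k}`. -/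
theorem half_transversal [NeZero k] (v : ZMod (2 * k)) :
    v + (k : ZMod (2 * k)) ∈ {v : ZMod (2 * k) | v.val < k} ↔
      v ∉ {v : ZMod (2 * k) | v.val < k} := by
  change (v + (k : ZMod (2 * k))).val < k ↔ ¬ v.val < k
  have hk := NeZero.pos k
  have hkv : (k : ZMod (2 * k)).val = k := ZMod.val_cast_of_lt (by omega)
  have hv := v.val_lt
  rw [ZMod.val_add, hkv]
  by_cases h : v.val < k
  · rw [Nat.mod_eq_of_lt (by omega)]; omega
  · rw [Nat.mod_eq_sub_mod (by omega), Nat.mod_eq_of_lt (by omega)]; omega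

theorem exists_eq_nsmul_of_gcd_eq_one [NeZero k] {c : ℤ} (hc : Int.gcd c k = 1) (z : ZMod k) :
    ∃ j : ℕ, z = j • (c : ZMod k) := by
  have hu : IsUnit (c : ZMod k) := 
    (ZMod.coe_int_isUnit_iff_isCoprime c k).2 (Int.isCoprime_iff_gcd_eq_one.2 hc).symm
  obtain ⟨u, hu⟩ := hu
  refine ⟨(z * (↑u⁻¹ : ZMod k)).val, ?_⟩
  rw [nsmul_eq_mul, ZMod.natCast_zmod_val, ← hu, Units.inv_mul_cancel_right]

end Circulant

/-! ### The hamiltonicity criterion -/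

section Hamiltonian

open Equiv Equiv.Perm

variable {k : ℕ} [NeZero k] {a b : ℤ}

theorem cayZMod_adj_iff (v w : ZMod (2 * k)) :
    (cayZMod (2 * k) {a, b, b + (k : ℤ)}).Adj v w ↔
      w = v + a ∨ modHalf k w = modHalf k v + modHalf k (b : ZMod (2 * k)) := by
  rw [← map_add, isPairing_modHalf.eq_iff]
  simp [cayZMod, add_assoc]

theorem isTransitive_addRight {n : ℕ} [NeZero n] {c : ℤ} (hc : Int.gcd c n = 1) :
    (Equiv.addRight (c : ZMod n)).IsTransitive := by
  intro x y
  obtain ⟨j, hj⟩ := exists_eq_nsmul_of_gcd_eq_one hc (y - x)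
  refine ⟨j, ?_⟩
  rw [zpow_natCast, Equiv.nsmul_addRight, Equiv.coe_addRight, ← hj]
  exact add_sub_cancel x y

theorem sign_addRight (a : ℤ) : sign (Equiv.addRight (a : ZMod (2 * k))) = Int.negOnePow a := by
  have hk := NeZero.pos k
  have h1 : sign (Equiv.addRight (1 : ZMod (2 * k))) = -1 := by
    have ht : (Equiv.addRight (1 : ZMod (2 * k))).IsTransitive := by
      simpa using isTransitive_addRight (n := 2 * k) (c := 1) (by simp)
    refine ht.sign_eq (by simp [ZMod.card]) ?_
    have : Fact (1 < 2 * k) := ⟨by omega⟩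
    infer_instance
  have h2 : Equiv.addRight (a : ZMod (2 * k)) = Equiv.addRight (1 : ZMod (2 * k)) ^ a := by
    rw [Equiv.zsmul_addRight]; simp
  rw [h2, map_zpow, h1]; rfl

/-- Since a hamiltonian circuit is an odd permutation, a mixed one requires `a` and `k` to have the
same parity. -/
theorem sign_eq_neg_one_iff_of_isMixed (hk : k ≠ 1) (hgcd : Int.gcd (b - a) k = 1)
    {s : Perm (ZMod (2 * k))}
    (hs : IsMixed (modHalf k) (k : ZMod (2 * k)) (a : ZMod (2 * k)) (b : ZMod (2 * k)) s) :
    sign s = -1 ↔ (Even a ↔ Even k) := by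
  have : Fact (1 < k) := ⟨by have := NeZero.pos k; omega⟩
  rw [hs.sign_eq isPairing_modHalf fun z => by
    simpa only [modHalf_intCast, Int.cast_sub] using exists_eq_nsmul_of_gcd_eq_one hgcd z,
    sign_addRight, ZMod.card]
  rcases Int.even_or_odd a with ha | ha <;> rcases Nat.even_or_odd k with hk | hk
  · simp [ha, hk, Int.negOnePow_even]
  · simp [ha, hk, Int.negOnePow_even, hk.neg_one_pow]
  · simp [ha, hk, Int.negOnePow_odd]
  · simp [ha, Int.negOnePow_odd, hk.neg_one_pow, Int.not_even_iff_odd.2 ha,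
      Nat.not_even_iff_odd.2 hk]

/-- No nontrivial congruence class is preserved by a permutation with a single cycle. -/
theorem eq_one_of_isTransitive {n d : ℕ} (hd : d ∣ n) {s : Perm (ZMod n)} (hs : s.IsTransitive)
    (h : ∀ v, ZMod.castHom hd (ZMod d) (s v) = ZMod.castHom hd (ZMod d) v) : d = 1 := by
  have := (hs 0 1).apply_eq_of_forall _ h
  rw [map_zero, map_one, ← Nat.cast_zero, ← Nat.cast_one, ZMod.natCast_eq_natCast_iff] at this
  simpa using (Nat.modEq_iff_dvd' zero_le_one).1 this

omit [NeZero k] in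
theorem castHom_eq_zero {d : ℕ} (hd : d ∣ 2 * k) {z : ℤ} (hz : (d : ℤ) ∣ z) :
    ZMod.castHom hd (ZMod d) (z : ZMod (2 * k)) = 0 := by
  rw [map_intCast, ZMod.intCast_zmod_eq_zero_iff_dvd]
  exact hz

/-- A step by `b` or `b + k` preserves residues modulo a common divisor of `b` and `k`. -/
theorem castHom_half_step {d : ℕ} (hd : d ∣ 2 * k) (hdk : (d : ℤ) ∣ k) (hdb : (d : ℤ) ∣ b)
    {v w : ZMod (2 * k)}
    (h : modHalf k w = modHalf k v + modHalf k (b : ZMod (2 * k))) :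
    ZMod.castHom hd (ZMod d) w = ZMod.castHom hd (ZMod d) v := by
  have hκ : ZMod.castHom hd (ZMod d) (k : ZMod (2 * k)) = 0 := by
    simpa using castHom_eq_zero hd hdk
  rw [← map_add, isPairing_modHalf.eq_iff] at h
  rcases h with rfl | rfl
  · rw [map_add, castHom_eq_zero hd hdb, add_zero]
  · rw [map_add, map_add, castHom_eq_zero hd hdb, hκ, add_zero, add_zero]

theorem conditions_of_isTransitive {s : Perm (ZMod (2 * k))}
    (hadj : ∀ v, (cayZMod (2 * k) {a, b, b + (k : ℤ)}).Adj v (s v)) (hs : s.IsTransitive) :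
    Int.gcd (Int.gcd a b : ℤ) (k : ℤ) = 1 ∧
      (Int.gcd (a - b) (k : ℤ) ≠ 1 ∨ Int.gcd a (2 * (k : ℤ)) = 1 ∨ Int.gcd b (k : ℤ) = 1 ∨
        (Even a ∧ Even k) ∨ (Odd a ∧ (Odd b ∨ Odd k))) := by
  simp only [cayZMod_adj_iff] at hadj
  constructor
  · have hdk : ((Int.gcd (Int.gcd a b : ℤ) (k : ℤ) : ℕ) : ℤ) ∣ k := Int.gcd_dvd_right _ _
    have hd := Int.gcd_dvd_left (Int.gcd a b : ℤ) (k : ℤ)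
    have hda := hd.trans (Int.gcd_dvd_left a b)
    have hdb := hd.trans (Int.gcd_dvd_right a b)
    have hd2 := (Int.natCast_dvd_natCast.1 hdk).mul_left 2
    refine eq_one_of_isTransitive hd2 hs fun v => ?_
    rcases hadj v with h | h
    · rw [h, map_add, castHom_eq_zero hd2 hda, add_zero]
    · exact castHom_half_step hd2 hdk hdb h
  by_cases hc : Int.gcd (a - b) (k : ℤ) = 1
  swap
  · exact Or.inl hc
  right
  by_cases hk : k = 1
  · subst hk; simp
  have hc' : Int.gcd (b - a) (k : ℤ) = 1 := by rw [← neg_sub, Int.neg_gcd]; exact hc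
  have hgen : ∀ z : ZMod k, ∃ j : ℕ, z = j • (modHalf k (b : ZMod (2 * k)) -
      modHalf k (a : ZMod (2 * k))) := fun z => by
    simpa only [modHalf_intCast, Int.cast_sub] using exists_eq_nsmul_of_gcd_eq_one hc' z
  have hab : modHalf k (a : ZMod (2 * k)) ≠ modHalf k (b : ZMod (2 * k)) := by
    rw [modHalf_intCast, modHalf_intCast, Ne, ZMod.intCast_eq_intCast_iff_dvd_sub]
    intro hd
    have := Int.gcd_eq_right (by positivity) hd
    omega
  rcases isPairing_modHalf.trichotomy hab hgen hadj with h | h | h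
  · left
    have hd2 : Int.gcd a (2 * (k : ℤ)) ∣ 2 * k := by
      exact_mod_cast Int.gcd_dvd_right a (2 * (k : ℤ))
    refine eq_one_of_isTransitive hd2 hs fun v => ?_
    rw [h, map_add, castHom_eq_zero hd2 (Int.gcd_dvd_left _ _), add_zero]
  · right; left
    have hdk : ((Int.gcd b (k : ℤ) : ℕ) : ℤ) ∣ k := Int.gcd_dvd_right _ _
    have hd2 := (Int.natCast_dvd_natCast.1 hdk).mul_left 2
    exact eq_one_of_isTransitive hd2 hs fun v =>
      castHom_half_step hd2 hdk (Int.gcd_dvd_left _ _) (h v)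
  · right; right
    have : Fact (1 < 2 * k) := ⟨by have := NeZero.pos k; omega⟩
    have hp := (sign_eq_neg_one_iff_of_isMixed hk hc' h).1
      (hs.sign_eq (by simp [ZMod.card]) inferInstance)
    rcases Int.even_or_odd a with ha | ha
    · exact Or.inl ⟨ha, hp.1 ha⟩
    · refine Or.inr ⟨ha, Or.inr (Nat.not_even_iff_odd.1 fun hn => ?_)⟩
      exact (Int.not_even_iff_odd.2 ha) (hp.2 hn)

/-- One of `b` and `b + k` is odd, hence a generator of `ZMod (2 * k)`, if `b` is prime to `k`. -/
theorem exists_isTransitive_of_gcd_eq_one_right (hb : Int.gcd b (k : ℤ) = 1) :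
    ∃ s : Perm (ZMod (2 * k)), (∀ v, modHalf k (s v) = modHalf k v + modHalf k (b : ZMod (2 * k)))
      ∧ s.IsTransitive := by
  have hodd : ∀ c : ℤ, Odd c → Int.gcd c (k : ℤ) = 1 → Int.gcd c ((2 * k : ℕ) : ℤ) = 1 := by
    intro c hc hck
    rw [← Int.isCoprime_iff_gcd_eq_one] at hck ⊢
    push_cast
    exact IsCoprime.mul_right (Int.isCoprime_two_right.2 hc) hck
  rcases Int.even_or_odd b with h | h
  · have hk : Odd (k : ℤ) := by
      by_contra hn
      rw [Int.not_odd_iff_even] at hn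
      have := Int.dvd_coe_gcd h.two_dvd hn.two_dvd
      rw [hb] at this
      norm_num at this
    refine ⟨Equiv.addRight ((b + k : ℤ) : ZMod (2 * k)), fun v => ?_,
      isTransitive_addRight (hodd _ (h.add_odd hk) (by simpa using hb))⟩
    rw [Equiv.coe_addRight, map_add, modHalf_intCast, modHalf_intCast]
    simp
  · refine ⟨Equiv.addRight (b : ZMod (2 * k)), fun v => ?_, isTransitive_addRight (hodd _ h hb)⟩
    rw [Equiv.coe_addRight, map_add]

/-- No coset of the subgroup generated by `a ≠ 0` is contained in `[0, k)`: the interval `[k, 2k)`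
contains a full set of residues modulo `gcd a (2 * k) ≤ k`. -/
theorem exists_add_nsmul_notMem (ha : ¬ (2 * k : ℤ) ∣ a) (v : ZMod (2 * k)) :
    ∃ j : ℕ, v + j • (a : ZMod (2 * k)) ∉ {v : ZMod (2 * k) | v.val < k} := by
  have hk : (0 : ℤ) < k := by exact_mod_cast NeZero.pos k
  set g : ℤ := ((Int.gcd a (2 * (k : ℤ)) : ℕ) : ℤ) with hg
  have hg0 : 0 < g := by
    have : 0 < Int.gcd a (2 * (k : ℤ)) := Int.gcd_pos_of_ne_zero_right _ (by omega)
    omega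
  have hgk : g ≤ k := by
    obtain ⟨q, hq⟩ : g ∣ 2 * k := Int.gcd_dvd_right _ _
    have hq0 : 0 < q := by
      by_contra hn
      nlinarith
    have hq1 : q ≠ 1 := by
      rintro rfl
      apply ha
      rw [hq, mul_one]
      exact Int.gcd_dvd_left _ _
    have : 2 ≤ q := by omega
    nlinarith
  set z : ℤ := k + (v.val - k) % g with hz
  have hz1 : (k : ℤ) ≤ z := by have := Int.emod_nonneg ((v.val : ℤ) - k) hg0.ne'; omega
  have hz2 : z < 2 * k := by have := Int.emod_lt_of_pos ((v.val : ℤ) - k) hg0; omega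
  have hzv : z = v.val - g * ((v.val - k) / g) := by
    have := Int.emod_add_mul_ediv ((v.val : ℤ) - k) g
    rw [hz]; linarith
  have hbez : g = a * Int.gcdA a (2 * k) + 2 * k * Int.gcdB a (2 * k) := Int.gcd_eq_gcd_ab _ _
  have hgz : (g : ZMod (2 * k)) = Int.gcdA a (2 * k) • (a : ZMod (2 * k)) := by
    have h2k : (2 * k : ZMod (2 * k)) = 0 := by exact_mod_cast ZMod.natCast_self (2 * k)
    have := congrArg (Int.cast : ℤ → ZMod (2 * k)) hbez
    push_cast at this
    rw [h2k, zero_mul, add_zero] at this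
    rw [this, zsmul_eq_mul]; exact mul_comm _ _
  obtain ⟨j, hj⟩ := exists_nsmul_eq_zsmul (a : ZMod (2 * k))
    (-(((v.val : ℤ) - k) / g) * Int.gcdA a (2 * k))
  refine ⟨j, ?_⟩
  have hvz : v + j • (a : ZMod (2 * k)) = ((z.toNat : ℕ) : ZMod (2 * k)) := by
    have h1 : ((z.toNat : ℕ) : ZMod (2 * k)) = (z : ZMod (2 * k)) := by
      rw [← Int.cast_natCast, Int.toNat_of_nonneg (by omega)]
    rw [h1, hj, mul_smul, ← hgz, hzv, zsmul_eq_mul]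
    push_cast
    rw [ZMod.natCast_zmod_val]
    ring
  rw [hvz, Set.mem_ofPred_eq, ZMod.val_cast_of_lt (by omega)]
  omega

theorem exists_isTransitive_of_even_iff (hk : k ≠ 1) (ha : ¬ (2 * k : ℤ) ∣ a)
    (hgcd : Int.gcd (b - a) k = 1) (hpar : Even a ↔ Even k) :
    ∃ s : Perm (ZMod (2 * k)),
      IsMixed (modHalf k) (k : ZMod (2 * k)) (a : ZMod (2 * k)) (b : ZMod (2 * k)) s ∧
      s.IsTransitive := by
  refine exists_isMixed_isTransitive isPairing_modHalf (by simp [ZMod.card]) (fun z => ?_)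
    (fun s hs => (sign_eq_neg_one_iff_of_isMixed hk hgcd hs).2 hpar)
    (exists_isMergeable isPairing_modHalf half_transversal (exists_add_nsmul_notMem ha))
  obtain ⟨i, hi⟩ := exists_eq_nsmul_of_gcd_eq_one hgcd z
  obtain ⟨j, hj⟩ := exists_nsmul_eq_zsmul (modHalf k (a : ZMod (2 * k))) (-i)
  refine ⟨i, j, ?_⟩
  rw [hi, hj, modHalf_intCast, modHalf_intCast, neg_smul, natCast_zsmul, Int.cast_sub, smul_sub,
    sub_eq_add_neg]

theorem exists_isTransitive_of_gcd_sub_ne_one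
    (hgcd : Int.gcd (Int.gcd a b : ℤ) (k : ℤ) = 1) (hab : Int.gcd (a - b) (k : ℤ) ≠ 1) :
    ∃ s : Perm (ZMod (2 * k)),
      (∀ v, (cayZMod (2 * k) {a, b, b + (k : ℤ)}).Adj v (s v)) ∧ s.IsTransitive := by
  have hk := NeZero.pos k
  set g := Int.gcd (a - b) (k : ℤ) with hg
  have hg0 : 0 < g := Int.gcd_pos_of_ne_zero_right _ (by omega)
  have : NeZero g := ⟨hg0.ne'⟩
  have hgk : (g : ℤ) ∣ k := Int.gcd_dvd_right _ _
  have hgab : (g : ℤ) ∣ a - b := Int.gcd_dvd_left _ _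
  have hg2 : g ∣ 2 * k := (Int.natCast_dvd_natCast.1 hgk).mul_left 2
  have hag : Int.gcd a g = 1 := by
    have h1 : ((Int.gcd a g : ℕ) : ℤ) ∣ a := Int.gcd_dvd_left _ _
    have h2 : ((Int.gcd a g : ℕ) : ℤ) ∣ g := Int.gcd_dvd_right _ _
    have h3 : ((Int.gcd a g : ℕ) : ℤ) ∣ b := by
      have := dvd_sub h1 (h2.trans hgab)
      rwa [sub_sub_cancel] at this
    have := Int.dvd_coe_gcd (Int.dvd_coe_gcd h1 h3) (h2.trans hgk)
    rw [hgcd] at this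
    exact Nat.dvd_one.1 (by exact_mod_cast this)
  let l : ZMod (2 * k) →+ ZMod g := (ZMod.castHom hg2 (ZMod g)).toAddMonoidHom
  have hl : ∀ z : ℤ, l (z : ZMod (2 * k)) = z := fun z => by simp [l]
  have hlκ : l (k : ZMod (2 * k)) = 0 := by
    have : (k : ZMod (2 * k)) = ((k : ℤ) : ZMod (2 * k)) := by simp
    rw [this, hl, ZMod.intCast_zmod_eq_zero_iff_dvd]
    exact hgk
  have hlab : l (a : ZMod (2 * k)) = l (b : ZMod (2 * k)) := by
    rw [hl, hl, ← sub_eq_zero, ← Int.cast_sub, ZMod.intCast_zmod_eq_zero_iff_dvd]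
    exact hgab
  have hla : l (a : ZMod (2 * k)) ≠ 0 := by
    rw [hl, Ne, ZMod.intCast_zmod_eq_zero_iff_dvd]
    intro hd
    have := Int.gcd_eq_right (by positivity) hd
    omega
  have hL : ∀ z : ZMod g, ∃ j : ℕ, z + j • l (a : ZMod (2 * k)) = 0 := fun z => by
    obtain ⟨j, hj⟩ := exists_eq_nsmul_of_gcd_eq_one hag (-z)
    exact ⟨j, by rw [hl, ← hj, add_neg_cancel]⟩
  have hgen : ∀ v, l v = 0 → ∃ j : ℕ, modHalf k v =
      j • (modHalf k (b : ZMod (2 * k)) - modHalf k (a : ZMod (2 * k))) := fun v hv => by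
    obtain ⟨z, rfl⟩ := ZMod.intCast_surjective v
    rw [hl, ZMod.intCast_zmod_eq_zero_iff_dvd] at hv
    obtain ⟨t, rfl⟩ := hv
    have hbez : (g : ℤ) = (a - b) * Int.gcdA (a - b) k + k * Int.gcdB (a - b) k :=
      Int.gcd_eq_gcd_ab _ _
    obtain ⟨j, hj⟩ := exists_nsmul_eq_zsmul (modHalf k (b : ZMod (2 * k)) -
      modHalf k (a : ZMod (2 * k))) (-(t * Int.gcdA (a - b) k))
    refine ⟨j, ?_⟩
    rw [hj, hbez]
    simp only [modHalf_intCast, zsmul_eq_mul]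
    push_cast
    rw [CharP.cast_eq_zero (ZMod k) k]
    ring
  obtain ⟨s, hs, ht⟩ := exists_isLayered_isTransitive isPairing_modHalf hlκ hlab hla hL hgen
    half_transversal
  exact ⟨s, fun v => (cayZMod_adj_iff _ _).2 (hs.eq_or v), ht⟩

theorem isTransitive_of_conditions (hgcd : Int.gcd (Int.gcd a b : ℤ) (k : ℤ) = 1)
    (hcond : Int.gcd (a - b) (k : ℤ) ≠ 1 ∨ Int.gcd a (2 * (k : ℤ)) = 1 ∨
      Int.gcd b (k : ℤ) = 1 ∨ (Even a ∧ Even k) ∨ (Odd a ∧ (Odd b ∨ Odd k))) :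
    ∃ s : Perm (ZMod (2 * k)),
      (∀ v, (cayZMod (2 * k) {a, b, b + (k : ℤ)}).Adj v (s v)) ∧ s.IsTransitive := by
  by_cases hab : Int.gcd (a - b) (k : ℤ) = 1
  swap
  · exact exists_isTransitive_of_gcd_sub_ne_one hgcd hab
  by_cases hb : Int.gcd b (k : ℤ) = 1
  · obtain ⟨s, hs, ht⟩ := exists_isTransitive_of_gcd_eq_one_right hb
    exact ⟨s, fun v => (cayZMod_adj_iff _ _).2 (Or.inr (hs v)), ht⟩
  by_cases ha : Int.gcd a (2 * (k : ℤ)) = 1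
  · exact ⟨Equiv.addRight (a : ZMod (2 * k)), fun v => (cayZMod_adj_iff _ _).2 (Or.inl rfl),
      isTransitive_addRight (by exact_mod_cast ha)⟩
  have hk : k ≠ 1 := by rintro rfl; simp at hb
  have hab' : Int.gcd (b - a) (k : ℤ) = 1 := by rw [← neg_sub, Int.neg_gcd]; exact hab
  have hpar : Even a ↔ Even k := by
    rcases hcond with h | h | h | ⟨h1, h2⟩ | ⟨h1, h2⟩
    · exact absurd hab h
    · exact absurd h ha
    · exact absurd h hb
    · simp [h1, h2]
    · have hkodd : Odd k := by
        rcases h2 with h2 | h2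
        · by_contra hn
          rw [Nat.not_odd_iff_even] at hn
          have h3 : (2 : ℤ) ∣ k := by exact_mod_cast hn.two_dvd
          have := Int.dvd_coe_gcd (h1.sub_odd h2).two_dvd h3
          rw [hab] at this
          norm_num at this
        · exact h2
      simp [← Int.not_odd_iff_even, ← Nat.not_odd_iff_even, h1, hkodd]
  have ha2 : ¬ (2 * k : ℤ) ∣ a := by
    intro hd
    apply hb
    have h1 : ((Int.gcd b k : ℕ) : ℤ) ∣ k := Int.gcd_dvd_right _ _
    have h2 : ((Int.gcd b k : ℕ) : ℤ) ∣ a := (h1.mul_left 2).trans hd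
    have := Int.dvd_coe_gcd (Int.dvd_coe_gcd h2 (Int.gcd_dvd_left b k)) h1
    rw [hgcd] at this
    exact Nat.dvd_one.1 (by exact_mod_cast this)
  obtain ⟨s, hs, ht⟩ := exists_isTransitive_of_even_iff hk ha2 hab' hpar
  refine ⟨s, fun v => (cayZMod_adj_iff _ _).2 ?_, ht⟩
  rcases hs v with ⟨h, -⟩ | ⟨-, h⟩
  exacts [Or.inl h, Or.inr h]

theorem hasHamiltonianCircuit_cayZMod_iff (k : ℕ) [NeZero k] (a b : ℤ) :
    (cayZMod (2 * k) {a, b, b + (k : ℤ)}).HasHamiltonianCircuit ↔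
      (Int.gcd (Int.gcd a b : ℤ) (k : ℤ) = 1 ∧
        (Int.gcd (a - b) (k : ℤ) ≠ 1 ∨ Int.gcd a (2 * (k : ℤ)) = 1 ∨ Int.gcd b (k : ℤ) = 1 ∨
          (Even a ∧ Even k) ∨ (Odd a ∧ (Odd b ∨ Odd k)))) := by
  rw [hasHamiltonianCircuit_iff]
  exact ⟨fun ⟨_, hs, ht⟩ => conditions_of_isTransitive hs ht,
    fun h => isTransitive_of_conditions h.1 h.2⟩

end Hamiltonian

/-! ### Nonhamiltonian examples -/

section Infinite

theorem isStronglyConnected_two_three (n : ℕ) [NeZero n] {A : Set ℤ} (h2 : (2 : ℤ) ∈ A)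
    (h3 : (3 : ℤ) ∈ A) : (cayZMod n A).IsStronglyConnected := by
  intro u v
  have htwo : ∀ (w : ZMod n) (i : ℕ),
      Relation.ReflTransGen (cayZMod n A).Adj w (w + 2 * i) := by
    intro w i
    induction i with
    | zero => simpa using Relation.ReflTransGen.refl
    | succ i ih => exact ih.tail ⟨2, h2, by push_cast; ring⟩
  -- a step by `3` followed by `n - 1` steps by `2` amounts to a step by `1`
  have hone : ∀ w : ZMod n, Relation.ReflTransGen (cayZMod n A).Adj w (w + 1) := by
    intro w
    have := (Relation.ReflTransGen.single (⟨3, h3, rfl⟩ :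
      (cayZMod n A).Adj w (w + ((3 : ℤ) : ZMod n)))).trans (htwo _ (n - 1))
    convert this using 1
    rw [Nat.cast_sub (NeZero.pos n)]
    push_cast
    rw [CharP.cast_eq_zero]
    ring
  have hnat : ∀ i : ℕ, Relation.ReflTransGen (cayZMod n A).Adj u (u + i) := by
    intro i
    induction i with
    | zero => simpa using Relation.ReflTransGen.refl
    | succ i ih => exact (ih.trans (hone _)).trans (by rw [Nat.cast_succ, add_assoc])
  have := hnat (v - u).val
  rwa [ZMod.natCast_zmod_val, add_sub_cancel] at this

/-- If `k ≥ 9` is an odd multiple of `3`, then `a = 2` and `b = 3` give a nonhamiltonian digraph. -/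
theorem three_mul_mem_nonhamiltonian (m : ℕ) :
    3 * (2 * m + 3) ∈ {k : ℕ | ∃ (_ : NeZero k) (a b : ℤ),
      (cayZMod (2 * k) {a, b, b + (k : ℤ)}).IsLoopless ∧
      (cayZMod (2 * k) {a, b, b + (k : ℤ)}).HasOutdegree 3 ∧
      (cayZMod (2 * k) {a, b, b + (k : ℤ)}).IsStronglyConnected ∧
      ¬ (cayZMod (2 * k) {a, b, b + (k : ℤ)}).HasHamiltonianCircuit} := by
  set k := 3 * (2 * m + 3) with hk
  have hk0 : NeZero k := ⟨by omega⟩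
  have hne : ∀ x y : ℤ, 0 ≤ x → x < y → y < 2 * k →
      (x : ZMod (2 * k)) ≠ (y : ZMod (2 * k)) := by
    intro x y hx hxy hy hn
    rw [ZMod.intCast_eq_intCast_iff_dvd_sub] at hn
    have := Int.le_of_dvd (by omega) hn
    push_cast at this
    omega
  refine ⟨hk0, 2, 3, ?_, ?_, isStronglyConnected_two_three _ (by simp) (by simp), ?_⟩
  · rintro u ⟨c, hc, hu⟩
    have hu0 : ((0 : ℤ) : ZMod (2 * k)) = (c : ZMod (2 * k)) := by
      rw [Int.cast_zero]; exact (left_eq_add.1 hu).symm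
    rcases hc with rfl | rfl | rfl
    all_goals exact hne _ _ le_rfl (by omega) (by omega) hu0
  · intro u
    have : {v | (cayZMod (2 * k) {2, 3, 3 + (k : ℤ)}).Adj u v} =
        (fun c : ℤ => u + (c : ZMod (2 * k))) '' {2, 3, 3 + (k : ℤ)} := by
      ext v
      simp only [cayZMod, Set.mem_ofPred_eq, Set.mem_image]
      exact exists_congr fun c => and_congr_right fun _ => eq_comm
    rw [this, Set.InjOn.ncard_image, Set.ncard_eq_three.2
      ⟨2, 3, 3 + (k : ℤ), by omega, by omega, by omega, rfl⟩]
    intro x hx y hy hxy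
    have hxy := add_left_cancel hxy
    have hbd : ∀ z ∈ ({2, 3, 3 + (k : ℤ)} : Set ℤ), 0 ≤ z ∧ z < 2 * k := by
      rintro z (rfl | rfl | rfl) <;> constructor <;> omega
    rcases lt_trichotomy x y with h | h | h
    · exact absurd hxy (hne _ _ (hbd x hx).1 h (hbd y hy).2)
    · exact h
    · exact absurd hxy.symm (hne _ _ (hbd y hy).1 h (hbd x hx).2)
  · rw [hasHamiltonianCircuit_cayZMod_iff]
    rintro ⟨-, h | h | h | ⟨-, h⟩ | ⟨h, -⟩⟩
    · simp at h
    · have := Int.dvd_coe_gcd (dvd_refl (2 : ℤ)) (dvd_mul_right (2 : ℤ) k)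
      rw [h] at this
      norm_num at this
    · have h3 : (3 : ℤ) ∣ k := ⟨2 * m + 3, by rw [hk]; push_cast; ring⟩
      have := Int.dvd_coe_gcd (dvd_refl (3 : ℤ)) h3
      rw [h] at this
      norm_num at this
    · obtain ⟨r, hr⟩ := h; omega
    · obtain ⟨r, hr⟩ := h; omega

end Infinite

theorem theorem4p6 :
    (∀ (k : ℕ) [NeZero k] (a b : ℤ),
      (cayZMod (2 * k) {a, b, b + (k : ℤ)}).HasHamiltonianCircuit ↔
        (Int.gcd (Int.gcd a b : ℤ) (k : ℤ) = 1 ∧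
          (Int.gcd (a - b) (k : ℤ) ≠ 1 ∨
            Int.gcd a (2 * (k : ℤ)) = 1 ∨
            Int.gcd b (k : ℤ) = 1 ∨
            (Even a ∧ Even k) ∨
            (Odd a ∧ (Odd b ∨ Odd k))))) ∧
    {k : ℕ | ∃ (_ : NeZero k) (a b : ℤ),
      (cayZMod (2 * k) {a, b, b + (k : ℤ)}).IsLoopless ∧
      (cayZMod (2 * k) {a, b, b + (k : ℤ)}).HasOutdegree 3 ∧
      (cayZMod (2 * k) {a, b, b + (k : ℤ)}).IsStronglyConnected ∧
      ¬ (cayZMod (2 * k) {a, b, b + (k : ℤ)}).HasHamiltonianCircuit}.Infinite := by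
  refine ⟨fun k _ a b => hasHamiltonianCircuit_cayZMod_iff k a b, ?_⟩
  refine Set.infinite_of_injective_forall_mem (f := fun m : ℕ => 3 * (2 * m + 3))
    (fun m m' h => ?_) three_mul_mem_nonhamiltonian
  simp only at h
  omega
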